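/- Let $n\ge 3$. A (deterministic, finite-state, complete) automaton with $n$ states is a set $\Sigma\subset\{0,1\}^{n\times n}$ of row-stochastic matrices, called letters. It is synchronizing if some finite product of letters equals $e^{T}e_i$ for some $1\le i\le n$, where $e$ is the $1\times n$ all-ones vector and $e_i$ is the $i$th standard $1\times n$ basis vector. For $t\in\mathbb N$ let $A(t)$ be the set of all columns of products of at most $t$ letters (the empty product being the identity matrix), and let the triple rendezvous time $T_{3,\Sigma}$ be the smallest $t$ such that $A(t)$ contains a vector with at least three non-zero entries; in other words, $T_{3,\Sigma}$ is the length of a shortest word that maps three distinct states to a single state. If $\Sigma$ is a synchronizing automaton with $n$ states, then $T_{3,\Sigma}$ exists and $$T_{3,\Sigma}\le \frac{n(n+4)}{4}-\frac{n \bmod 2}{4}.$$ -/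

import Mathlib

/-- A (deterministic, finite state, complete) automaton with `n` states: a set of letters, each
letter being a row-stochastic `n × n` matrix with entries in `{0, 1}`. The row `q` of a letter is
the characteristic vector of the state to which the letter sends the state `q`. -/
structure DFAutomaton (n : ℕ) where
  letters : Set (Matrix (Fin n) (Fin n) ℝ)
  binary : ∀ L ∈ letters, ∀ i j, L i j = 0 ∨ L i j = 1
  stochastic : ∀ L ∈ letters, L ∈ Matrix.rowStochastic ℝ (Fin n)

namespace DFAutomaton

variable {n : ℕ}

/-- The set of products of exactly `t` letters. -/
def wordsOfLength (S : DFAutomaton n) (t : ℕ) : Set (Matrix (Fin n) (Fin n) ℝ) :=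
  {W | ∃ w : List (Matrix (Fin n) (Fin n) ℝ), (∀ L ∈ w, L ∈ S.letters) ∧ w.length = t ∧ w.prod = W}

/-- The set of products of at most `t` letters; it contains the identity (the empty product). -/
def wordsUpTo (S : DFAutomaton n) (t : ℕ) : Set (Matrix (Fin n) (Fin n) ℝ) :=
  {W | ∃ s ≤ t, W ∈ S.wordsOfLength s}

/-- Some product of letters has all its rows equal to one standard basis vector `e_i`, that is,
it equals `eᵀ e_i` with `e` the all-ones row vector. -/
def IsSynchronizing (S : DFAutomaton n) : Prop :=
  ∃ i : Fin n, ∃ t : ℕ, Matrix.vecMulVec 1 (Pi.single i 1) ∈ S.wordsOfLength t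

/-- The vectors reachable at `t`: the columns of the products of at most `t` letters. -/
def reachable (S : DFAutomaton n) (t : ℕ) : Set (Fin n → ℝ) :=
  {v | ∃ W ∈ S.wordsUpTo t, ∃ j : Fin n, v = W.col j}

/-- The weight of a vector: the number of its non-zero entries. -/
noncomputable def weight (v : Fin n → ℝ) : ℕ :=
  {i | v i ≠ 0}.ncard

/-- The lengths `t` at which some reachable vector has weight at least `3`. -/
def tripleTimes (S : DFAutomaton n) : Set ℕ :=
  {t | ∃ v ∈ S.reachable t, 3 ≤ weight v}

/-- The triple rendezvous time `T₃`: the least element of `S.tripleTimes` (the value is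
meaningful only if this set is non-empty). -/
noncomputable def tripleRendezvousTime (S : DFAutomaton n) : ℕ :=
  sInf S.tripleTimes

end DFAutomaton

open Matrix Filter Topology

namespace TripleRendezvous

variable {n : ℕ}

/-! Consider the linear program that maximizes ∑ xᵢ over x ≥ 0 with x · v ≤ 1 for all v in A(t).
Before the rendezvous time every v has weight at most 2, so this is the fractional stable set
problem of a graph. Its optimum is half-integral, and the deficiency j = 2(n − optimum) is an
integer with j ≤ n and j ≠ 1 (`exists_deficiency`). The optimal face has dimension d ≤ j/2.

Enlarging A(t) cannot decrease j. If j is stationary, then d drops (`finrank_lt`): otherwise the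
affine hull of the face would be invariant under all letters, which a synchronizing word forbids. So
(j, −d) increases lexicographically, and the time is bounded by the number of admissible pairs
(`le_of_lexicographic`). -/

/-- The fractional packings of a family `A` of vectors. -/
def packing (A : Set (Fin n → ℝ)) : Set (Fin n → ℝ) :=
  {x | (∀ i, 0 ≤ x i) ∧ ∀ v ∈ A, x ⬝ᵥ v ≤ 1}

/-- The fractional packings of maximal total mass. -/
def optimal (A : Set (Fin n → ℝ)) : Set (Fin n → ℝ) :=
  {x | x ∈ packing A ∧ ∀ z ∈ packing A, ∑ i, z i ≤ ∑ i, x i}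

/-- A family of `0/1`-vectors that contains the standard basis. -/
structure IsBinaryFamily (A : Set (Fin n → ℝ)) : Prop where
  binary : ∀ v ∈ A, ∀ i, v i = 0 ∨ v i = 1
  single_mem : ∀ i, Pi.single i 1 ∈ A

theorem IsBinaryFamily.finite {A : Set (Fin n → ℝ)} (hA : IsBinaryFamily A) : A.Finite :=
  (Set.Finite.pi (fun _ : Fin n => ((Set.finite_singleton (1 : ℝ)).insert 0))).subset
    fun v hv i _ => by simpa using hA.binary v hv i

theorem packing_le_one {A : Set (Fin n → ℝ)} (hA : IsBinaryFamily A) {x : Fin n → ℝ}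
    (hx : x ∈ packing A) (i : Fin n) : x i ≤ 1 := by
  simpa using hx.2 _ (hA.single_mem i)

theorem packing_antitone {A B : Set (Fin n → ℝ)} (h : A ⊆ B) : packing B ⊆ packing A :=
  fun _ hx => ⟨hx.1, fun v hv => hx.2 v (h hv)⟩

theorem optimal_nonempty {A : Set (Fin n → ℝ)} (hA : IsBinaryFamily A) :
    (optimal A).Nonempty := by
  have hclosed : IsClosed (packing A) := by
    have : packing A = (⋂ i, {x | 0 ≤ x i}) ∩ ⋂ v ∈ A, {x | x ⬝ᵥ v ≤ 1} := by
      ext x; simp [packing]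
    rw [this]
    refine (isClosed_iInter fun i => isClosed_le (by fun_prop) (by fun_prop)).inter
      (isClosed_biInter fun v _ => isClosed_le ?_ (by fun_prop))
    unfold dotProduct
    fun_prop
  have hcomp : IsCompact (packing A) :=
    (isCompact_univ_pi (fun _ : Fin n => isCompact_Icc (a := (0 : ℝ)) (b := 1))).of_isClosed_subset
      hclosed fun x hx i _ => ⟨hx.1 i, packing_le_one hA hx i⟩
  obtain ⟨x, hx, hmax⟩ := hcomp.exists_isMaxOn ⟨0, by simp [packing]⟩
    (f := fun x : Fin n → ℝ => ∑ i, x i) (by fun_prop)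
  exact ⟨x, hx, fun z hz => hmax hz⟩

theorem optimal_of_sum_eq {A : Set (Fin n → ℝ)} {x y : Fin n → ℝ} (hx : x ∈ optimal A)
    (hy : y ∈ packing A) (h : ∑ i, x i = ∑ i, y i) : y ∈ optimal A :=
  ⟨hy, fun z hz => h ▸ hx.2 z hz⟩

theorem optimal_sum_eq {A : Set (Fin n → ℝ)} {x y : Fin n → ℝ} (hx : x ∈ optimal A)
    (hy : y ∈ optimal A) : ∑ i, x i = ∑ i, y i :=
  le_antisymm (hy.2 x hx.1) (hx.2 y hy.1)

theorem convex_optimal (A : Set (Fin n → ℝ)) : Convex ℝ (optimal A) := by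
  intro x hx y hy a b ha hb hab
  refine optimal_of_sum_eq hx ⟨fun i => ?_, fun v hv => ?_⟩ ?_
  · have := hx.1.1 i
    have := hy.1.1 i
    simp only [Pi.add_apply, Pi.smul_apply, smul_eq_mul]
    positivity
  · have h1 := mul_le_mul_of_nonneg_left (hx.1.2 v hv) ha
    have h2 := mul_le_mul_of_nonneg_left (hy.1.2 v hv) hb
    rw [add_dotProduct, smul_dotProduct, smul_dotProduct, smul_eq_mul, smul_eq_mul]
    linarith
  · have h := optimal_sum_eq hx hy
    simp only [Pi.add_apply, Pi.smul_apply, smul_eq_mul, Finset.sum_add_distrib,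
      ← Finset.mul_sum, ← h, ← add_mul, hab, one_mul]

/-- A direction that respects the active constraints does not increase the total mass. -/
theorem sum_nonpos_of_direction {A : Set (Fin n → ℝ)} (hA : A.Finite) {x s : Fin n → ℝ}
    (hx : x ∈ optimal A) (h0 : ∀ i, x i = 0 → 0 ≤ s i)
    (h1 : ∀ v ∈ A, x ⬝ᵥ v = 1 → s ⬝ᵥ v ≤ 0) : ∑ i, s i ≤ 0 := by
  have e1 : ∀ᶠ ε : ℝ in 𝓝[>] 0, ∀ i, 0 ≤ x i + ε * s i := by
    refine eventually_all.2 fun i => ?_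
    rcases (hx.1.1 i).eq_or_lt with h | h
    · filter_upwards [self_mem_nhdsWithin] with ε hε
      have := mul_nonneg (le_of_lt hε) (h0 i h.symm)
      linarith
    · have : Tendsto (fun ε : ℝ => x i + ε * s i) (𝓝[>] 0) (𝓝 (x i + 0 * s i)) :=
        (Continuous.tendsto (by fun_prop) 0).mono_left nhdsWithin_le_nhds
      filter_upwards [this.eventually_const_lt (u := 0) (by simpa using h)] with ε hε
      exact hε.le
  have e2 : ∀ᶠ ε : ℝ in 𝓝[>] 0, ∀ v ∈ A, x ⬝ᵥ v + ε * (s ⬝ᵥ v) ≤ 1 := by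
    refine (eventually_all_finite hA).2 fun v hv => ?_
    rcases (hx.1.2 v hv).eq_or_lt with h | h
    · filter_upwards [self_mem_nhdsWithin] with ε hε
      have := mul_nonneg (le_of_lt hε) (neg_nonneg.2 (h1 v hv h))
      linarith
    · have : Tendsto (fun ε : ℝ => x ⬝ᵥ v + ε * (s ⬝ᵥ v)) (𝓝[>] 0)
          (𝓝 (x ⬝ᵥ v + 0 * (s ⬝ᵥ v))) :=
        (Continuous.tendsto (by fun_prop) 0).mono_left nhdsWithin_le_nhds
      filter_upwards [this.eventually_lt_const (u := 1) (by simpa using h)] with ε hε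
      exact hε.le
  obtain ⟨ε, ⟨k1, k2⟩, hε⟩ := ((e1.and e2).and self_mem_nhdsWithin).exists
  have := hx.2 (x + ε • s) ⟨fun i => by simpa using k1 i, fun v hv => by
    simpa [add_dotProduct, smul_dotProduct] using k2 v hv⟩
  simp only [Pi.add_apply, Pi.smul_apply, smul_eq_mul, Finset.sum_add_distrib,
    ← Finset.mul_sum] at this
  have hε : 0 < ε := hε
  nlinarith

theorem exists_tight {A : Set (Fin n → ℝ)} (hA : IsBinaryFamily A) {x : Fin n → ℝ}
    (hx : x ∈ optimal A) (i : Fin n) : ∃ v ∈ A, v i = 1 ∧ x ⬝ᵥ v = 1 := by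
  by_contra! h
  have := sum_nonpos_of_direction hA.finite hx (s := Pi.single i 1)
    (fun j _ => by rw [Pi.single_apply]; split_ifs <;> simp)
    (fun v hv ht => by
      rcases hA.binary v hv i with h0 | h0
      · simp [h0]
      · exact absurd ht (h v hv h0))
  simp at this
  linarith

/-- A convex set has a point that satisfies only those of finitely many linear equations that hold
on the whole set. -/
theorem exists_generic {O : Set (Fin n → ℝ)} (hO : Convex ℝ O) (hne : O.Nonempty)
    (C : Finset ((Fin n → ℝ) × ℝ)) :
    ∃ x ∈ O, ∀ c ∈ C, x ⬝ᵥ c.1 = c.2 → ∀ z ∈ O, z ⬝ᵥ c.1 = c.2 := by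
  classical
  induction C using Finset.induction_on with
  | empty => obtain ⟨x, hx⟩ := hne; exact ⟨x, hx, by simp⟩
  | insert c C _ ih =>
    obtain ⟨x, hx, h⟩ := ih
    by_cases hc : x ⬝ᵥ c.1 = c.2 → ∀ z ∈ O, z ⬝ᵥ c.1 = c.2
    · refine ⟨x, hx, fun d hd => ?_⟩
      rcases Finset.mem_insert.1 hd with rfl | hd
      exacts [hc, h d hd]
    push Not at hc
    obtain ⟨hxc, z, hz, hzc⟩ := hc
    have key : ∀ᶠ ε : ℝ in 𝓝[>] 0, ∀ d ∈ C, x ⬝ᵥ d.1 ≠ d.2 →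
        (1 - ε) * (x ⬝ᵥ d.1) + ε * (z ⬝ᵥ d.1) ≠ d.2 := by
      refine (eventually_all_finset C).2 fun d _ => ?_
      by_cases hd : x ⬝ᵥ d.1 = d.2
      · exact Eventually.of_forall fun _ h => absurd hd h
      have : Tendsto (fun ε : ℝ => (1 - ε) * (x ⬝ᵥ d.1) + ε * (z ⬝ᵥ d.1)) (𝓝[>] 0)
          (𝓝 ((1 - 0) * (x ⬝ᵥ d.1) + 0 * (z ⬝ᵥ d.1))) :=
        (Continuous.tendsto (by fun_prop) 0).mono_left nhdsWithin_le_nhds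
      filter_upwards [this.eventually_ne (by simpa using hd)] with ε hε _ using hε
    obtain ⟨ε, hε, hI⟩ := (key.and (Ioo_mem_nhdsGT (zero_lt_one' ℝ))).exists
    refine ⟨(1 - ε) • x + ε • z, hO hx hz (by linarith [hI.2]) hI.1.le (by ring), ?_⟩
    intro d hd hd'
    rw [add_dotProduct, smul_dotProduct, smul_dotProduct, smul_eq_mul, smul_eq_mul] at hd'
    rcases Finset.mem_insert.1 hd with rfl | hd
    · refine absurd ?_ hzc
      rw [hxc] at hd'
      have : ε * (z ⬝ᵥ d.1 - d.2) = 0 := by linarith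
      rcases mul_eq_zero.1 this with h | h
      · exact absurd h hI.1.ne'
      · linarith
    · by_cases hxd : x ⬝ᵥ d.1 = d.2
      · exact h d hd hxd
      · exact absurd hd' (hε d hd hxd)

/-! ### Weight at most two: half-integrality and the optimal face. -/

/-- Every vector of the family has at most two non-zero entries. -/
def IsGraphic (A : Set (Fin n → ℝ)) : Prop :=
  ∀ v ∈ A, v = 0 ∨ (∃ i, v = Pi.single i 1) ∨ ∃ i j, i ≠ j ∧ v = Pi.single i 1 + Pi.single j 1

theorem isGraphic_of_weight_le {A : Set (Fin n → ℝ)} (hA : IsBinaryFamily A)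
    (h : ∀ v ∈ A, DFAutomaton.weight v ≤ 2) : IsGraphic A := by
  intro v hv
  have h01 := hA.binary v hv
  have hset : ∀ k, v k = Set.indicator {i | v i ≠ 0} 1 k := by
    intro k
    rcases h01 k with h | h <;> simp [h]
  have hw : {i | v i ≠ 0}.ncard ≤ 2 := h v hv
  interval_cases hc : {i | v i ≠ 0}.ncard
  · left
    rw [Set.ncard_eq_zero] at hc
    ext k
    rw [hset k, hc]; simp
  · right; left
    obtain ⟨i, hi⟩ := Set.ncard_eq_one.1 hc
    refine ⟨i, ?_⟩
    ext k
    rw [hset k, hi]; simp [Pi.single_apply]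
  · right; right
    obtain ⟨i, j, hij, hi⟩ := Set.ncard_eq_two.1 hc
    refine ⟨i, j, hij, ?_⟩
    ext k
    rw [hset k, hi]
    by_cases h1 : k = i
    · subst h1
      simp [hij]
    · by_cases h2 : k = j <;> simp [h1, h2, hij.symm]

theorem half_mem_packing {A : Set (Fin n → ℝ)} (hG : IsGraphic A) :
    (fun _ => 1 / 2 : Fin n → ℝ) ∈ packing A := by
  refine ⟨fun i => by norm_num, fun v hv => ?_⟩
  rcases hG v hv with rfl | ⟨i, rfl⟩ | ⟨i, j, -, rfl⟩ <;> norm_num [dotProduct_add]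

theorem half_le_sum {A : Set (Fin n → ℝ)} (hG : IsGraphic A) {x : Fin n → ℝ}
    (hx : x ∈ optimal A) : (n : ℝ) / 2 ≤ ∑ i, x i := by
  have := hx.2 _ (half_mem_packing hG)
  simp at this
  linarith

/-- The rounding of a number to the nearest of `0` and `1`, with `1/2` fixed. -/
noncomputable def round (r : ℝ) : ℝ := if r < 1 / 2 then 0 else if r = 1 / 2 then 1 / 2 else 1

/-- The displacement `round x - x` vanishes where x does and is orthogonal to every tight
constraint, so both it and its negative are admissible directions at an optimum. Hence the optimum
is a half-integer. -/
theorem sum_round {A : Set (Fin n → ℝ)} (hA : IsBinaryFamily A) (hG : IsGraphic A)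
    {x : Fin n → ℝ} (hx : x ∈ optimal A) : ∑ i, round (x i) = ∑ i, x i := by
  have t0 : ∀ r : ℝ, r = 0 → round r - r = 0 := by
    rintro r rfl; norm_num [round]
  have t1 : ∀ r : ℝ, r = 1 → round r - r = 0 := by
    rintro r rfl; norm_num [round]
  have t2 : ∀ a b : ℝ, a + b = 1 → round a - a + (round b - b) = 0 := by
    intro a b hab
    grind [round]
  have tight : ∀ v ∈ A, x ⬝ᵥ v = 1 → (fun i => round (x i) - x i) ⬝ᵥ v = 0 := by
    intro v hv ht
    rcases hG v hv with rfl | ⟨i, rfl⟩ | ⟨i, j, -, rfl⟩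
    · simp
    · simp at ht ⊢
      exact t1 _ ht
    · simp [dotProduct_add] at ht ⊢
      exact t2 _ _ ht
  have a := sum_nonpos_of_direction hA.finite hx (s := fun i => round (x i) - x i)
    (fun i hi => (t0 _ hi).ge) (fun v hv ht => (tight v hv ht).le)
  have b := sum_nonpos_of_direction hA.finite hx (s := -fun i => round (x i) - x i)
    (fun i hi => by simp only [Pi.neg_apply, t0 _ hi]; simp)
    (fun v hv ht => by rw [neg_dotProduct, tight v hv ht]; simp)
  simp only [Pi.neg_apply, Finset.sum_neg_distrib, Finset.sum_sub_distrib] at a b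
  linarith

/-- For generic x, a direction of the face is determined by its coordinates where x < 1/2. It
vanishes where x = 1/2. Where x > 1/2, a tight constraint either forces it to vanish or ties it to a
partner coordinate with x < 1/2. -/
theorem finrank_vectorSpan_le {A : Set (Fin n → ℝ)} {x : Fin n → ℝ}
    (hA : IsBinaryFamily A) (hG : IsGraphic A) (hx : x ∈ optimal A)
    (h1 : ∀ v ∈ A, x ⬝ᵥ v = 1 → ∀ z ∈ optimal A, z ⬝ᵥ v = 1)
    (h2 : ∀ i, x i = 1 / 2 → ∀ z ∈ optimal A, z i = 1 / 2) :
    Module.finrank ℝ (vectorSpan ℝ (optimal A)) ≤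
      (Finset.univ.filter fun i => x i < 1 / 2).card := by
  have s1 : ∀ v ∈ A, x ⬝ᵥ v = 1 → ∀ d ∈ vectorSpan ℝ (optimal A), d ⬝ᵥ v = 0 := by
    intro v hv ht d hd
    induction hd using Submodule.span_induction with
    | mem d hd =>
      obtain ⟨a, ha, b, hb, rfl⟩ := hd
      simp [sub_dotProduct, h1 v hv ht a ha, h1 v hv ht b hb]
    | zero => simp
    | add a b _ _ ha hb => rw [add_dotProduct, ha, hb, add_zero]
    | smul c a _ ha => rw [smul_dotProduct, ha, smul_zero]
  have s2 : ∀ i, x i = 1 / 2 → ∀ d ∈ vectorSpan ℝ (optimal A), d i = 0 := by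
    intro i hi d hd
    induction hd using Submodule.span_induction with
    | mem d hd =>
      obtain ⟨a, ha, b, hb, rfl⟩ := hd
      simp [h2 i hi a ha, h2 i hi b hb]
    | zero => simp
    | add a b _ _ ha hb => simp [ha, hb]
    | smul c a _ ha => simp [ha]
  let f : vectorSpan ℝ (optimal A) →ₗ[ℝ] ({i // x i < 1 / 2} → ℝ) :=
    (LinearMap.funLeft ℝ ℝ (Subtype.val : {i // x i < 1 / 2} → Fin n)).comp
      (vectorSpan ℝ (optimal A)).subtype
  have hf : Function.Injective f := by
    rw [← LinearMap.ker_eq_bot, LinearMap.ker_eq_bot']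
    rintro ⟨d, hd⟩ hd0
    have hlow : ∀ i, x i < 1 / 2 → d i = 0 := fun i hi => congrFun hd0 ⟨i, hi⟩
    ext i
    change d i = 0
    rcases lt_trichotomy (x i) (1 / 2) with hi | hi | hi
    · exact hlow i hi
    · exact s2 i hi d hd
    · obtain ⟨v, hv, hvi, ht⟩ := exists_tight hA hx i
      have hdv := s1 v hv ht d hd
      rcases hG v hv with rfl | ⟨j, rfl⟩ | ⟨j, k, hjk, rfl⟩
      · simp at hvi
      · have : i = j := by by_contra h; simp [h] at hvi
        subst this
        simpa using hdv
      · simp [dotProduct_add] at ht hdv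
        by_cases hij : i = j
        · subst hij
          rw [hlow k (by linarith)] at hdv
          linarith
        · by_cases hik : i = k
          · subst hik
            rw [hlow j (by linarith)] at hdv
            linarith
          · simp [hij, hik] at hvi
  have := LinearMap.finrank_le_finrank_of_injective hf
  rwa [Module.finrank_fintype_fun_eq_card, Fintype.card_subtype] at this

theorem exists_deficiency {A : Set (Fin n → ℝ)} (hA : IsBinaryFamily A) (hG : IsGraphic A) :
    ∃ j : ℕ, (∀ z ∈ optimal A, (j : ℝ) = 2 * (n - ∑ i, z i)) ∧ j ≤ n ∧ j ≠ 1 ∧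
      2 * Module.finrank ℝ (vectorSpan ℝ (optimal A)) ≤ j := by
  classical
  obtain ⟨x, hx, hgen⟩ := exists_generic (convex_optimal A) (optimal_nonempty hA)
    (hA.finite.toFinset.image (fun v => (v, (1 : ℝ))) ∪
      Finset.univ.image fun i : Fin n => ((Pi.single i 1 : Fin n → ℝ), (1 / 2 : ℝ)))
  have hdim := finrank_vectorSpan_le hA hG hx
    (fun v hv => hgen (v, 1) (Finset.mem_union_left _
      (Finset.mem_image_of_mem _ (hA.finite.mem_toFinset.2 hv))))
    (fun i hi z hz => by
      have := hgen (Pi.single i 1, 1 / 2) (Finset.mem_union_right _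
        (Finset.mem_image_of_mem _ (Finset.mem_univ i))) (by simpa using hi) z hz
      simpa using this)
  -- This is 2(1 − `round (x i)`), so each coordinate below 1/2, which may add a dimension, costs 2.
  let k : Fin n → ℕ := fun i => if x i < 1 / 2 then 2 else if x i = 1 / 2 then 1 else 0
  have hk : ((∑ i, k i : ℕ) : ℝ) = 2 * (n - ∑ i, x i) := by
    have : ∀ i, (k i : ℝ) = 2 * (1 - round (x i)) := by
      intro i
      simp only [k, round]
      split_ifs <;> norm_num
    rw [← sum_round hA hG hx]
    push_cast
    simp only [this, ← Finset.mul_sum, Finset.sum_sub_distrib]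
    simp
  refine ⟨∑ i, k i, fun z hz => by rw [hk, optimal_sum_eq hz hx], ?_, ?_, ?_⟩
  · have := half_le_sum hG hx
    have : ((∑ i, k i : ℕ) : ℝ) ≤ n := by linarith
    exact_mod_cast this
  -- An edge constraint xᵢ + xⱼ ≤ 1 already costs deficiency 2; without edges the all-ones vector is
  -- a packing and the deficiency is 0.
  · intro h1
    rw [h1] at hk
    push_cast at hk
    by_cases hE : ∃ i j, i ≠ j ∧ (Pi.single i 1 + Pi.single j 1 : Fin n → ℝ) ∈ A
    · obtain ⟨i, j, hij, hmem⟩ := hE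
      have hle := hx.1.2 _ hmem
      simp [dotProduct_add] at hle
      have hs := Finset.sum_le_sum_of_subset_of_nonneg (f := fun i => 1 - x i)
        (Finset.subset_univ {i, j}) (fun l _ _ => sub_nonneg.2 (packing_le_one hA hx.1 l))
      rw [Finset.sum_pair hij, Finset.sum_sub_distrib] at hs
      simp at hs
      linarith
    · have := hx.2 (fun _ => 1) ⟨fun i => zero_le_one, fun v hv => by
        rcases hG v hv with rfl | ⟨i, rfl⟩ | ⟨i, j, hij, rfl⟩
        · simp
        · simp
        · exact absurd ⟨i, j, hij, hv⟩ hE⟩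
      simp at this
      linarith
  · refine (Nat.mul_le_mul_left 2 hdim).trans ?_
    rw [Finset.card_filter, Finset.mul_sum]
    refine Finset.sum_le_sum fun i _ => ?_
    simp only [k]
    split_ifs <;> simp

/-! ### Counting the lexicographic steps. -/

theorem le_of_lexicographic {T N : ℕ} (j d : ℕ → ℕ) (hd : ∀ t < T, 2 * d t ≤ j t)
    (hN : ∀ t < T, j t ≤ N) (hj : ∀ t < T, j t ≠ 1)
    (hstep : ∀ t, t + 1 < T → j t < j (t + 1) ∨ j t = j (t + 1) ∧ d (t + 1) < d t)
    (h2 : 2 ≤ N) : T + 1 ≤ ((N + 2) / 2) * ((N + 3) / 2) := by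
  -- `G j` is the sum of ⌊i/2⌋ + 1 over i ≤ j, the number of pairs (i, d) with 2d ≤ i ≤ j.
  let G : ℕ → ℕ := fun j => ((j + 2) / 2) * ((j + 3) / 2)
  have hG : ∀ j, G (j + 1) = G j + ((j + 1) / 2 + 1) := by
    intro j
    rcases Nat.even_or_odd' j with ⟨m, rfl | rfl⟩
    · simp only [G]
      rw [show (2 * m + 1 + 2) / 2 = m + 1 by omega, show (2 * m + 1 + 3) / 2 = m + 2 by omega,
        show (2 * m + 2) / 2 = m + 1 by omega,
        show (2 * m + 1) / 2 = m by omega]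
      ring
    · simp only [G]
      rw [show (2 * m + 1 + 1 + 2) / 2 = m + 2 by omega,
        show (2 * m + 1 + 1 + 3) / 2 = m + 2 by omega,
        show (2 * m + 1 + 2) / 2 = m + 1 by omega,
        show (2 * m + 1 + 1) / 2 = m + 1 by omega]
      ring
  have hmono : Monotone G := monotone_nat_of_le_succ fun j => by rw [hG]; omega
  have hlt : ∀ a b, a < b → G a + (b / 2 + 1) ≤ G b := by
    intro a b hab
    obtain ⟨c, rfl⟩ : ∃ c, b = c + 1 := ⟨b - 1, by omega⟩
    rw [hG]
    have := hmono (show a ≤ c by omega)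
    omega
  have G0 : G 0 = 1 := rfl
  have G1 : G 1 = 2 := rfl
  -- The summand 2, rather than 1, records that the excluded value j = 1 saves one pair. Value 0
  -- occurs only at time 0, since there d = 0 cannot drop.
  have main : ∀ t < T, (j t = 0 → t = 0) ∧ (2 ≤ j t → t + 2 + d t ≤ G (j t)) := by
    intro t
    induction t with
    | zero =>
      intro h0
      refine ⟨fun _ => rfl, fun h => ?_⟩
      have := hlt 1 (j 0) (by omega)
      have := hd 0 h0
      omega
    | succ t ih =>
      intro ht
      obtain ⟨i1, i2⟩ := ih (by omega)
      have d0 := hd t (by omega)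
      have d1 := hd _ ht
      have j1 := hj _ ht
      have j0 := hj t (by omega)
      rcases hstep t ht with h | ⟨h, h'⟩
      · refine ⟨by omega, fun hge => ?_⟩
        have b1 := hlt 1 (j (t + 1)) (by omega)
        have b2 := hlt _ _ h
        by_cases hz : j t = 0
        · have := i1 hz
          omega
        · have := i2 (by omega)
          omega
      · refine ⟨by omega, fun hge => ?_⟩
        rw [← h]
        have := i2 (by omega)
        omega
  change T + 1 ≤ G N
  have hGN := hmono h2
  have G2 : G 2 = 4 := rfl
  rcases Nat.eq_zero_or_pos T with h | h
  · omega
  have := main (T - 1) (by omega)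
  have := hmono (hN (T - 1) (by omega))
  have := hj (T - 1) (by omega)
  omega

/-! ### Letters acting on vectors and on packings. -/

theorem letter_row {S : DFAutomaton n} {L : Matrix (Fin n) (Fin n) ℝ} (hL : L ∈ S.letters)
    (i : Fin n) : ∃ k, L i = Pi.single k 1 := by
  have hst := S.stochastic L hL
  have hsum : ∑ j, L i j = 1 := by
    have := congrFun hst.2 i
    simpa [mulVec, dotProduct] using this
  have hex : ∃ k, L i k = 1 := by
    by_contra! h
    have : ∀ j, L i j = 0 := fun j => (S.binary L hL i j).resolve_right (h j)
    simp [this] at hsum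
  obtain ⟨k, hk⟩ := hex
  refine ⟨k, ?_⟩
  ext j
  by_cases hj : j = k
  · subst hj; simpa using hk
  · rw [Pi.single_eq_of_ne hj]
    have h0 : ∀ l, 0 ≤ L i l := fun l => hst.1 i l
    have := Finset.sum_le_sum_of_subset_of_nonneg (Finset.subset_univ {j, k})
      (fun l _ _ => h0 l)
    rw [Finset.sum_pair hj, hsum, hk] at this
    linarith [h0 j]

theorem prod_row {S : DFAutomaton n} {w : List (Matrix (Fin n) (Fin n) ℝ)}
    (hw : ∀ L ∈ w, L ∈ S.letters) : ∀ i : Fin n, ∃ k, w.prod i = Pi.single k 1 := by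
  induction w with
  | nil =>
    intro i
    refine ⟨i, ?_⟩
    ext j
    simp [Matrix.one_apply, Pi.single_apply, eq_comm]
  | cons L w ih =>
    intro i
    obtain ⟨k, hk⟩ := letter_row (hw L (by simp)) i
    obtain ⟨l, hl⟩ := ih (fun M hM => hw M (by simp [hM])) k
    refine ⟨l, ?_⟩
    rw [List.prod_cons, Matrix.mul_apply_eq_vecMul, hk, Matrix.single_one_vecMul, ← hl]
    rfl

theorem isBinaryFamily_reachable (S : DFAutomaton n) (t : ℕ) :
    IsBinaryFamily (S.reachable t) where
  binary := by
    rintro v ⟨W, ⟨s, -, w, hw, -, rfl⟩, j, rfl⟩ i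
    obtain ⟨k, hk⟩ := prod_row hw i
    rw [Matrix.col_apply, hk, Pi.single_apply]
    split_ifs <;> simp
  single_mem i := by
    refine ⟨1, ⟨0, Nat.zero_le _, [], by simp, rfl, rfl⟩, i, ?_⟩
    ext j
    simp [Matrix.one_apply, Pi.single_apply]

theorem reachable_mono (S : DFAutomaton n) {s t : ℕ} (h : s ≤ t) :
    S.reachable s ⊆ S.reachable t := by
  rintro v ⟨W, ⟨r, hr, hW⟩, j, rfl⟩
  exact ⟨W, ⟨r, hr.trans h, hW⟩, j, rfl⟩

theorem mulVec_mem_reachable {S : DFAutomaton n} {t : ℕ} {L : Matrix (Fin n) (Fin n) ℝ}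
    (hL : L ∈ S.letters) {v : Fin n → ℝ} (hv : v ∈ S.reachable t) :
    L *ᵥ v ∈ S.reachable (t + 1) := by
  obtain ⟨W, ⟨s, hs, w, hw, rfl, rfl⟩, j, rfl⟩ := hv
  refine ⟨L * w.prod, ⟨w.length + 1, by omega, L :: w, ?_, by simp, by simp⟩, j, ?_⟩
  · intro M hM
    rcases List.mem_cons.1 hM with rfl | hM
    exacts [hL, hw M hM]
  · rfl

theorem sum_vecMul {S : DFAutomaton n} {L : Matrix (Fin n) (Fin n) ℝ} (hL : L ∈ S.letters)
    (x : Fin n → ℝ) : ∑ i, (x ᵥ* L) i = ∑ i, x i := by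
  have h : L *ᵥ 1 = 1 := (S.stochastic L hL).2
  rw [← dotProduct_one, ← dotProduct_mulVec, h, dotProduct_one]

/-- By duality (x L) · v = x · (L v), and L v is reachable one letter later. -/
theorem vecMul_mem_packing {S : DFAutomaton n} {t : ℕ} {L : Matrix (Fin n) (Fin n) ℝ}
    (hL : L ∈ S.letters) {x : Fin n → ℝ} (hx : x ∈ packing (S.reachable (t + 1))) :
    x ᵥ* L ∈ packing (S.reachable t) := by
  refine ⟨fun i => ?_, fun v hv => ?_⟩
  · exact dotProduct_nonneg_of_nonneg hx.1 fun j => (S.stochastic L hL).1 j i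
  rw [← dotProduct_mulVec]
  exact hx.2 _ (mulVec_mem_reachable hL hv)

/-- Some constraint is active on the whole optimal face. -/
theorem exists_common_tight [NeZero n] {A : Set (Fin n → ℝ)} (hA : IsBinaryFamily A) :
    ∃ v ∈ A, ∀ z ∈ optimal A, z ⬝ᵥ v = 1 := by
  classical
  obtain ⟨x, hx, hgen⟩ := exists_generic (convex_optimal A) (optimal_nonempty hA)
    (hA.finite.toFinset.image (fun v => (v, (1 : ℝ))))
  obtain ⟨v, hv, -, ht⟩ := exists_tight hA hx 0
  exact ⟨v, hv, hgen (v, 1)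
    (Finset.mem_image_of_mem _ (hA.finite.mem_toFinset.2 hv)) ht⟩

/-- In a synchronizing automaton the optimal face loses dimension when the optimum is stationary. -/
theorem finrank_lt {S : DFAutomaton n} (hS : S.IsSynchronizing) {t : ℕ} {x : Fin n → ℝ}
    (hx : x ∈ optimal (S.reachable (t + 1))) (hx' : x ∈ optimal (S.reachable t))
    (h1 : 1 < ∑ i, x i) :
    Module.finrank ℝ (vectorSpan ℝ (optimal (S.reachable (t + 1)))) <
      Module.finrank ℝ (vectorSpan ℝ (optimal (S.reachable t))) := by
  have hsub : optimal (S.reachable (t + 1)) ⊆ optimal (S.reachable t) := fun z hz =>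
    optimal_of_sum_eq hx' (packing_antitone (reachable_mono S (Nat.le_succ t)) hz.1)
      (optimal_sum_eq hx hz)
  refine Submodule.finrank_lt_finrank_of_lt (lt_of_le_of_ne (vectorSpan_mono ℝ hsub) fun heq => ?_)
  have hL : ∀ L ∈ S.letters, ∀ z ∈ optimal (S.reachable (t + 1)),
      z ᵥ* L ∈ optimal (S.reachable t) := fun L hL z hz =>
    optimal_of_sum_eq hx' (vecMul_mem_packing hL hz.1)
      ((optimal_sum_eq hx hz).trans (sum_vecMul hL z).symm)
  set V := vectorSpan ℝ (optimal (S.reachable t)) with hV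
  -- Letters map the later face into the earlier one; if both have the same direction space, that
  -- space is invariant.
  have hinv : ∀ L ∈ S.letters, ∀ d ∈ V, d ᵥ* L ∈ V := by
    intro L hLS d hd
    rw [← heq] at hd
    induction hd using Submodule.span_induction with
    | mem d hd =>
      obtain ⟨a, ha, b, hb, rfl⟩ := hd
      change (a - b) ᵥ* L ∈ V
      rw [sub_vecMul]
      exact vsub_mem_vectorSpan ℝ (hL L hLS a ha) (hL L hLS b hb)
    | zero => simp
    | add a b _ _ ha hb => rw [add_vecMul]; exact V.add_mem ha hb
    | smul c a _ ha => rw [smul_vecMul]; exact V.smul_mem c ha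
  have hword : ∀ w : List (Matrix (Fin n) (Fin n) ℝ), (∀ L ∈ w, L ∈ S.letters) →
      ∀ y, y - x ∈ V → y ᵥ* w.prod - x ∈ V := by
    intro w
    induction w with
    | nil => intro _ y hy; simpa using hy
    | cons L w ih =>
      intro hw y hy
      rw [List.prod_cons, ← vecMul_vecMul]
      refine ih (fun M hM => hw M (by simp [hM])) _ ?_
      have hLS := hw L (by simp)
      have e : y ᵥ* L - x = (y - x) ᵥ* L + (x ᵥ* L - x) := by rw [sub_vecMul]; abel
      rw [e]
      exact V.add_mem (hinv L hLS _ hy) (vsub_mem_vectorSpan ℝ (hL L hLS x hx) hx')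
  obtain ⟨i, s, w, hw, -, hprod⟩ := hS
  have hend := hword w hw x (by simp)
  have : NeZero n := ⟨by rintro rfl; exact i.elim0⟩
  have hA := isBinaryFamily_reachable S t
  obtain ⟨v, hv, hvt⟩ := exists_common_tight hA
  have hzero : ∀ d ∈ V, d ⬝ᵥ v = 0 := by
    intro d hd
    induction hd using Submodule.span_induction with
    | mem d hd =>
      obtain ⟨a, ha, b, hb, rfl⟩ := hd
      change (a - b) ⬝ᵥ v = 0
      rw [sub_dotProduct, hvt a ha, hvt b hb, sub_self]
    | zero => simp
    | add a b _ _ ha hb => rw [add_dotProduct, ha, hb, add_zero]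
    | smul c a _ ha => rw [smul_dotProduct, ha, smul_zero]
  -- The synchronizing word sends x to (∑ xₖ) eᵢ, still in the affine hull of the face, where v is
  -- constantly 1. So (∑ xₖ) vᵢ = 1 with vᵢ ∈ {0, 1}, against ∑ xₖ > 1.
  have h := hzero _ hend
  rw [sub_dotProduct, hvt x hx', hprod, vecMul_vecMulVec, dotProduct_one, smul_dotProduct,
    single_one_dotProduct, smul_eq_mul] at h
  rcases hA.binary v hv i with h0 | h0 <;> rw [h0] at h <;> linarith

/-! ### Existence and the bound. -/

theorem tripleTimes_nonempty (hn : 3 ≤ n) {S : DFAutomaton n} (hS : S.IsSynchronizing) :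
    S.tripleTimes.Nonempty := by
  obtain ⟨i, t, hW⟩ := hS
  refine ⟨t, _, ⟨_, ⟨t, le_rfl, hW⟩, i, rfl⟩, ?_⟩
  have : {k | (Matrix.vecMulVec (1 : Fin n → ℝ) (Pi.single i 1)).col i k ≠ 0} = Set.univ := by
    ext k
    simp
  rw [DFAutomaton.weight, this, Set.ncard_univ, Nat.card_fin]
  exact hn

theorem tripleRendezvousTime_succ_le (hn : 3 ≤ n) {S : DFAutomaton n} (hS : S.IsSynchronizing) :
    S.tripleRendezvousTime + 1 ≤ ((n + 2) / 2) * ((n + 3) / 2) := by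
  have hA := isBinaryFamily_reachable S
  have hG : ∀ t < S.tripleRendezvousTime, IsGraphic (S.reachable t) := by
    intro t ht
    refine isGraphic_of_weight_le (hA t) fun v hv => ?_
    by_contra! h
    exact Nat.notMem_of_lt_sInf ht ⟨v, hv, h⟩
  have hex : ∀ t, ∃ j : ℕ, t < S.tripleRendezvousTime →
      (∀ z ∈ optimal (S.reachable t), (j : ℝ) = 2 * (n - ∑ i, z i)) ∧ j ≤ n ∧ j ≠ 1 ∧
        2 * Module.finrank ℝ (vectorSpan ℝ (optimal (S.reachable t))) ≤ j := by
    intro t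
    by_cases ht : t < S.tripleRendezvousTime
    · obtain ⟨j, hj⟩ := exists_deficiency (hA t) (hG t ht)
      exact ⟨j, fun _ => hj⟩
    · exact ⟨0, fun h => absurd h ht⟩
  choose j hj using hex
  refine le_of_lexicographic j
    (fun t => Module.finrank ℝ (vectorSpan ℝ (optimal (S.reachable t))))
    (fun t ht => (hj t ht).2.2.2) (fun t ht => (hj t ht).2.1) (fun t ht => (hj t ht).2.2.1)
    (fun t ht => ?_) (by omega)
  have ht' : t < S.tripleRendezvousTime := by omega
  obtain ⟨x, hx⟩ := optimal_nonempty (hA (t + 1))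
  obtain ⟨y, hy⟩ := optimal_nonempty (hA t)
  have ex := (hj _ ht).1 x hx
  have ey := (hj _ ht').1 y hy
  have hxp := packing_antitone (reachable_mono S (Nat.le_succ t)) hx.1
  have hle := hy.2 x hxp
  have hjj : j t ≤ j (t + 1) := by
    have : (j t : ℝ) ≤ j (t + 1) := by linarith
    exact_mod_cast this
  refine hjj.lt_or_eq.imp id fun h => ⟨h, ?_⟩
  have hsum : ∑ i, y i = ∑ i, x i := by
    rw [h] at ey
    linarith
  refine finrank_lt hS hx (optimal_of_sum_eq hy hxp hsum) ?_
  -- Here n ≥ 3 matters: the optimum is at least n/2 ≥ 3/2 > 1.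
  have := half_le_sum (hG _ ht) hx
  have : (3 : ℝ) ≤ n := by exact_mod_cast hn
  linarith

end TripleRendezvous

theorem mainTheorem3 (n : ℕ) (hn : 3 ≤ n) (S : DFAutomaton n) (hS : S.IsSynchronizing) :
    S.tripleTimes.Nonempty ∧
      (S.tripleRendezvousTime : ℝ) ≤ (n : ℝ) * (n + 4) / 4 - ((n % 2 : ℕ) : ℝ) / 4 := by
  refine ⟨TripleRendezvous.tripleTimes_nonempty hn hS, ?_⟩
  have h := TripleRendezvous.tripleRendezvousTime_succ_le hn hS
  rcases Nat.even_or_odd' n with ⟨m, rfl | rfl⟩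
  · rw [show (2 * m + 2) / 2 = m + 1 by omega, show (2 * m + 3) / 2 = m + 1 by omega] at h
    rw [show 2 * m % 2 = 0 by omega]
    have h' : (S.tripleRendezvousTime : ℝ) + 1 ≤ (m + 1) * (m + 1) := by exact_mod_cast h
    push_cast
    linarith
  · rw [show (2 * m + 1 + 2) / 2 = m + 1 by omega,
      show (2 * m + 1 + 3) / 2 = m + 2 by omega] at h
    rw [show (2 * m + 1) % 2 = 1 by omega]
    have h' : (S.tripleRendezvousTime : ℝ) + 1 ≤ (m + 1) * (m + 2) := by exact_mod_cast h
    push_cast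
    linarith
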